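/- Let $\mathbb F_q$ be a finite field, and let $\sigma=\begin{pmatrix}a&b\\c&d\end{pmatrix}\in \mathrm{GL}_2(\mathbb F_q)$ with $dc\neq 0$. For $\tau=\begin{pmatrix}a'&b'\\c'&d'\end{pmatrix}\in\mathrm{GL}_2(\mathbb F_q)$ and a polynomial $f\in\mathbb F_q[x]$ of degree $n$ put $P_\tau(f)(x)=(c'x+d')^n f\left(\frac{a'x+b'}{c'x+d'}\right)$. For a positive integer $t$ put $S_t(f)(x)=f(x^t)$, and define the $R_{\sigma,t}$-transform by $g^{R_{\sigma,t}}=P_{\sigma^{-1}}(S_t(P_\sigma(g)))$. An element $\alpha\in\mathbb F_{q^n}$ is *normal* in $\mathbb F_{q^n}/\mathbb F_{q^s}$ (where $s\mid n$) if $\alpha,\alpha^{q^s},\dots,\alpha^{q^{s(n/s-1)}}$ are linearly independent over $\mathbb F_{q^s}$, and *completely normal* in $\mathbb F_{q^n}/\mathbb F_q$ if it is normal in $\mathbb F_{q^n}/\mathbb F_{q^s}$ for every divisor $s$ of $n$. A polynomial $f\in\mathbb F_q[x]$ is *completely normal* over $\mathbb F_q$ if it is irreducible and all its roots are completely normal in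 $\mathbb F_{q^{\deg f}}/\mathbb F_q$. **Theorem.** Let $A\in\mathbb F_q$ with $A\neq a/c$, let $g_0(x)=x-A$, and let $t\ge 2$ be an integer such that - every prime factor of $t$ divides $q-1$; - it is not the case that both $q\equiv 3 \pmod 4$ and $t$ is even; - for every prime $\ell\mid t$, the element $\eta(g_0;\sigma)=\left(-\frac dc\right)\, g_0\!\left(\frac bd\right)\, g_0\!\left(\frac ac\right)^{-1}$ is not an $\ell$-th power in $\mathbb F_q$. Define $g_k=g_{k-1}^{R_{\sigma,t}}$ for $k\ge 1$. Then: 1. If $ab=0$, then $g_k$ is completely normal over $\mathbb F_q$ for every $k\ge 0$. 2. If $ab\neq 0$ and $\frac{bc}{ad}$ is an $\ell$-th power in $\mathbb F_q$ for some prime $\ell\mid t$, then $g_k$ is completely normal over $\mathbb F_q$ for every $k\ge 1$, and also for $k=0$ provided that $A\neq 0$. 3. If $ab\neq 0$, $d=-c$ and $A\neq 0$, then $g_k$ is completely normal over $\mathbb F_q$ for every $k\ge 0$. -/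

import Mathlib

open Polynomial

namespace RTransform

universe u v

noncomputable section

/-- An element `α` of a (finite) extension `L / K` of a finite field `K` with `r = #K` is normal if
`α, α ^ r, …, α ^ (r ^ (m - 1))` are linearly independent over `K`, where `m = [L : K]`. -/
def IsNormalElement (K : Type u) (L : Type v) [Field K] [Field L] [Algebra K L] (α : L) : Prop :=
  LinearIndependent K
    (fun i : Fin (Module.finrank K L) => α ^ (Nat.card K ^ (i : ℕ)))

/-- `α` is completely normal in `L / K` if it is normal in `L / E` for every intermediate field `E`.
For `K = 𝔽_q` and `L = 𝔽_{q^n}` the intermediate fields are exactly the `𝔽_{q^d}` with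
`d ∣ n`. -/
def IsCompletelyNormalElement (K : Type u) (L : Type v) [Field K] [Field L] [Algebra K L]
    (α : L) : Prop :=
  ∀ E : IntermediateField K L, IsNormalElement E L α

/-- A polynomial over a finite field `F` is completely normal if it is irreducible and each of its
roots in an extension of degree `deg f` (that is, in `𝔽_{q^(deg f)}`) is completely normal. -/
def IsCompletelyNormalPoly {F : Type u} [Field F] (f : F[X]) : Prop :=
  Irreducible f ∧
    ∀ (L : Type u) [Field L] [Algebra F L], Module.finrank F L = f.natDegree →
      ∀ α : L, aeval α f = 0 → IsCompletelyNormalElement F L α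

variable {F : Type u} [Field F]

/-- `P_σ(f)(x) = (c x + d) ^ n * f ((a x + b) / (c x + d))` with `n = deg f`, as a polynomial. -/
def P (σ : Matrix.GeneralLinearGroup (Fin 2) F) (f : F[X]) : F[X] :=
  ∑ i ∈ Finset.range (f.natDegree + 1),
    C (f.coeff i) * (C (σ 0 0) * X + C (σ 0 1)) ^ i *
      (C (σ 1 0) * X + C (σ 1 1)) ^ (f.natDegree - i)

/-- The defining formula of `P` at a point where the denominator does not vanish. -/
theorem eval_P (σ : Matrix.GeneralLinearGroup (Fin 2) F) (f : F[X]) (x : F)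
    (hx : σ 1 0 * x + σ 1 1 ≠ 0) :
    (P σ f).eval x = (σ 1 0 * x + σ 1 1) ^ f.natDegree *
      f.eval ((σ 0 0 * x + σ 0 1) / (σ 1 0 * x + σ 1 1)) := by
  rw [P, eval_finsetSum, eval_eq_sum_range, Finset.mul_sum]
  refine Finset.sum_congr rfl fun i hi => ?_
  have hi' : i ≤ f.natDegree := Nat.lt_succ_iff.mp (Finset.mem_range.mp hi)
  simp only [eval_mul, eval_pow, eval_add, eval_C, eval_X]
  rw [div_pow, pow_sub₀ _ hx hi']
  field_simp

/-- `S_t(f)(x) = f(x ^ t)`. -/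
def S (t : ℕ) (f : F[X]) : F[X] := f.comp (X ^ t)

/-- The `R_{σ,t}`-transform `P_{σ⁻¹} ∘ S_t ∘ P_σ`. -/
def R (σ : Matrix.GeneralLinearGroup (Fin 2) F) (t : ℕ) (g : F[X]) : F[X] :=
  P σ⁻¹ (S t (P σ g))

/-- The sequence `g_0 = g`, `g_(k+1) = R_{σ,t}(g_k)`. -/
def gSeq (σ : Matrix.GeneralLinearGroup (Fin 2) F) (t : ℕ) (g : F[X]) : ℕ → F[X]
  | 0 => g
  | k + 1 => R σ t (gSeq σ t g k)

open Classical in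
/-- The element `η(g; σ)`, including the conventions for `c = 0` and for `d = 0`. -/
def eta (σ : Matrix.GeneralLinearGroup (Fin 2) F) (g : F[X]) : F :=
  if σ 1 0 = 0 then
    (-σ 1 1 / σ 0 0) ^ g.natDegree * g.eval (σ 0 1 / σ 1 1)
  else if σ 1 1 = 0 then
    (-σ 0 1 / σ 1 0) ^ g.natDegree * (g.eval (σ 0 0 / σ 1 0))⁻¹
  else
    (-σ 1 1 / σ 1 0) ^ g.natDegree * g.eval (σ 0 1 / σ 1 1) *
      (g.eval (σ 0 0 / σ 1 0))⁻¹

/-- The hypotheses of the Bassa–Menares irreducibility theorem on `σ`, `t` and `g`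
over the finite field `F` with `q = Nat.card F` elements. -/
structure BassaMenares (σ : Matrix.GeneralLinearGroup (Fin 2) F) (t : ℕ) (g : F[X]) : Prop where
  two_le : 2 ≤ t
  prime_dvd : ∀ ℓ : ℕ, ℓ.Prime → ℓ ∣ t → ℓ ∣ Nat.card F - 1
  monic : g.Monic
  irreducible : Irreducible g
  ne_pole : σ 1 0 ≠ 0 → g ≠ X - C (σ 0 0 / σ 1 0)
  even_degree : Nat.card F % 4 = 3 → Even t → Even g.natDegree
  eta_not_power : ∀ ℓ : ℕ, ℓ.Prime → ℓ ∣ t → ¬ ∃ y : F, eta σ g = y ^ ℓ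

end

end RTransform

/-! Write N = t^k and D = -d/c. `P σ` sends x - A to u(x - θ) with u = a - cA and θ = η(g_0; σ). In
the iteration each P_σ cancels the preceding P_{σ⁻¹}, so g_k = P_{σ⁻¹}(u(x^N - θ)) (`gSeq_X_sub_C`).
Its roots are α = (aβ + b)/(c(β - D)) with β^N = θ, and x^N - θ is irreducible since θ is not an
ℓ-th power for any prime ℓ ∣ t.

Fix an intermediate field E with Q elements, s = [E : F] and m = [L : E]. Then Θ = β^m lies in E,
and 1, β, …, β^(m-1) is an E-basis of L that the Frobenius of E permutes up to scalars through i ↦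
Qi mod m. The span of an orbit is a simple E[X]-module: each of its β^j generates it and is killed
by an irreducible X^r - w (`exists_irreducible_aeval_frobenius_eq_zero`). So an element with all
coordinates nonzero has the same annihilator as L itself, namely (X^m - 1), and is therefore normal
(`isNormalElement_of_sum_pow`).

The geometric sum for (β^m - D^m)/(β - D) yields the coordinates of α. All are visibly nonzero
except the constant one, which is proportional to aΘ + bD^(m-1). If a ≠ 0 and this vanished, Θ would
lie in F, making θ = ±Θ^s up to no sign at all, that is θ = Θ^s, a p-th power for every prime p ∣ s.
So only s = 1 matters, and the single remaining condition is aθ + bD^(N-1) ≠ 0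
(`isCompletelyNormalElement_linearFractional`). The three cases of the theorem are three ways to
guarantee it. -/

namespace RTransform

/-! ### Irreducibility of binomials. -/

/-- If `a` is not a `p`-th power for the primes `p ∣ n`, and `-1` is a square whenever `n` is even,
then `X ^ n - a` is irreducible. -/
theorem X_pow_sub_C_irreducible_of_isSquare_neg_one {K : Type*} [Field K] {n : ℕ} (hn : n ≠ 0)
    {a : K} (h2 : 2 ∣ n → IsSquare (-1 : K))
    (ha : ∀ p : ℕ, p.Prime → p ∣ n → ∀ b : K, b ^ p ≠ a) :
    Irreducible (X ^ n - C a) := by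
  induction n using induction_on_primes generalizing K a with
  | zero => exact absurd rfl hn
  | one => simpa using irreducible_X_sub_C a
  | prime_mul p n hp IH =>
    rw [mul_comm]
    apply X_pow_mul_sub_C_irreducible
      (X_pow_sub_C_irreducible_of_prime hp (ha p hp (dvd_mul_right _ _)))
    intro E _ _ x hx
    have hint : IsIntegral K x := not_not.mp fun h ↦ by
      simpa only [degree_zero, degree_X_pow_sub_C hp.pos,
        WithBot.natCast_ne_bot] using congr_arg degree (hx.symm.trans (dif_neg h))
    apply IH (right_ne_zero_of_mul hn)
    · intro h
      simpa using (h2 (h.mul_left p)).map (algebraMap K (IntermediateField.adjoin K {x}))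
    intro q hq hqn b hb
    -- If x^p = a and b^q = x, the norm of x gives N(b)^q = (-1)^(p+1) a. For p = 2 the sign is
    -- absorbed by a square root of -1 when q = 2, and by negating N(b) when q is odd.
    have hN : Algebra.norm K b ^ q = (-1) ^ p * (-a) := by
      rw [← map_pow, hb, ← IntermediateField.adjoin.powerBasis_gen hint,
        Algebra.PowerBasis.norm_gen_eq_coeff_zero_minpoly]
      simp [IntermediateField.minpoly_gen, hx, hp.ne_zero.symm]
    rcases hp.eq_two_or_odd' with rfl | hodd
    · obtain ⟨i, hi⟩ := h2 (dvd_mul_right _ _)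
      rcases hq.eq_two_or_odd' with rfl | hq'
      · apply ha 2 hq (dvd_mul_right _ _) (i * Algebra.norm K b)
        rw [mul_pow, hN, sq i, ← hi]; ring
      · apply ha q hq (hqn.mul_left _) (-Algebra.norm K b)
        rw [hq'.neg_pow, hN]; ring
    · apply ha q hq (hqn.mul_left _) (Algebra.norm K b)
      rw [hN, hodd.neg_one_pow]; ring

/-! ### Lifting the exponent for x^l - 1. -/

theorem coprime_of_forall_prime {m k : ℕ} (h : ∀ p : ℕ, p.Prime → p ∣ m → ¬ p ∣ k) :
    m.Coprime k :=
  Nat.coprime_of_dvd fun p hp h1 h2 => h p hp h1 h2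

/-- `1 + x + ⋯ + x ^ (l - 1) ≡ l` modulo every divisor of `x - 1`. -/
theorem geom_sum_modEq {x p : ℕ} (l : ℕ) (hx : x ≡ 1 [MOD p]) :
    ∑ i ∈ Finset.range l, x ^ i ≡ l [MOD p] := by
  induction l with
  | zero => simp [Nat.ModEq.refl]
  | succ l ih =>
    rw [Finset.sum_range_succ]
    simpa using ih.add (hx.pow l)

/-- Ensures that l divides the geometric sum exactly once. For odd l, expand x^i to first order in x
- 1; for l = 2 this needs x ≡ 1 mod 4. -/
theorem geom_sum_modEq_sq {x l : ℕ} (hl : l.Prime) (hx : x ≡ 1 [MOD l])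
    (h2 : l = 2 → x ≡ 1 [MOD 4]) :
    ∑ i ∈ Finset.range l, x ^ i ≡ l [MOD l ^ 2] := by
  rcases hl.eq_two_or_odd' with rfl | hodd
  · have := h2 rfl
    simp only [Finset.sum_range_succ, Finset.sum_range_zero, Nat.ModEq, pow_zero, pow_one] at this ⊢
    omega
  · have hpow : ∀ i : ℕ, ((x : ℤ) ^ i ≡ 1 + i * (x - 1) [ZMOD (l : ℤ) ^ 2]) := by
      have hd : (l : ℤ) ^ 2 ∣ ((x : ℤ) - 1) ^ 2 :=
        pow_dvd_pow_of_dvd ((Nat.modEq_iff_dvd.mp hx.symm).trans (by simp)) 2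
      intro i
      induction i with
      | zero => simp [Int.ModEq.refl]
      | succ i ih =>
        rw [pow_succ (x : ℤ) i]
        refine (ih.mul_right _).trans (Int.modEq_iff_dvd.mpr ?_)
        have : (1 + ((i + 1 : ℕ) : ℤ) * (x - 1)) - (1 + i * (x - 1)) * x
            = - (i * ((x : ℤ) - 1) ^ 2) := by push_cast; ring
        rw [this]
        exact (hd.mul_left _).neg_right
    have hsum : ((∑ i ∈ Finset.range l, x ^ i : ℕ) : ℤ) ≡
        ∑ i ∈ Finset.range l, (1 + (i : ℤ) * (x - 1)) [ZMOD (l : ℤ) ^ 2] := by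
      push_cast
      exact Int.ModEq.sum fun i _ => hpow i
    rw [Finset.sum_add_distrib, ← Finset.sum_mul, ← Nat.cast_sum] at hsum
    obtain ⟨k, hk⟩ := hodd
    have hid : ∑ i ∈ Finset.range l, i = l * k := by
      rw [Finset.sum_range_id, hk]
      simp only [Nat.add_sub_cancel]
      rw [mul_comm 2 k, ← mul_assoc, Nat.mul_div_cancel _ two_pos]
    rw [hid] at hsum
    rw [← Int.natCast_modEq_iff]
    push_cast at hsum ⊢
    refine hsum.trans (Int.modEq_iff_dvd.mpr ?_)
    obtain ⟨e, he⟩ := Nat.modEq_iff_dvd.mp hx.symm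
    simp only [Nat.cast_one] at he
    rw [he]
    exact ⟨-(k * e), by simp; ring⟩

/-- If `m ∣ (x ^ l - 1) / l` and all primes dividing `m` divide `x - 1`, then `m ∣ x - 1`. -/
theorem dvd_sub_one_of_dvd_pow_sub_one_div {m x l : ℕ} (hl : l.Prime) (hx : 1 ≤ x)
    (hp : ∀ p : ℕ, p.Prime → p ∣ m → p ∣ x - 1) (h2 : 2 ∣ m → 4 ∣ x - 1)
    (h : m * l ∣ x ^ l - 1 ∨ (¬ l ∣ m ∧ m ∣ x ^ l - 1)) : m ∣ x - 1 := by
  have hfac : x ^ l - 1 = (x - 1) * ∑ i ∈ Finset.range l, x ^ i := by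
    have := geom_sum_mul_of_one_le hx l
    rw [← this, mul_comm]
  have hmod : ∀ p : ℕ, p ∣ x - 1 → x ≡ 1 [MOD p] := fun p h =>
    ((Nat.modEq_iff_dvd' hx).mpr h).symm
  rw [hfac] at h
  by_cases hlm : l ∣ m
  · have h : m * l ∣ (x - 1) * ∑ i ∈ Finset.range l, x ^ i := by tauto
    have hsq := geom_sum_modEq_sq hl (hmod l (hp l hl hlm)) fun h => hmod 4 (h2 (h ▸ hlm))
    have hlS : l ∣ ∑ i ∈ Finset.range l, x ^ i :=
      (Nat.modEq_zero_iff_dvd).mp ((geom_sum_modEq l (hmod l (hp l hl hlm))).trans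
        (by simp [Nat.ModEq]))
    obtain ⟨s, hs⟩ := hlS
    rw [hs] at h hsq
    -- The sum is l * s. After cancelling l, no prime of m divides s: for l by the congruence mod
    -- l^2, for other primes because the sum is ≡ l.
    have h' : m ∣ (x - 1) * s := by
      have : m * l ∣ ((x - 1) * s) * l := by convert h using 1; ring
      exact Nat.dvd_of_mul_dvd_mul_right hl.pos this
    refine Nat.Coprime.dvd_of_dvd_mul_right (coprime_of_forall_prime fun p hpp hpm hps => ?_) h'
    by_cases hpl : p = l
    · subst hpl
      have h1 : p ^ 2 ∣ p * s := by rw [sq]; exact mul_dvd_mul_left _ hps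
      have h3 : p ^ 2 ∣ p := (Nat.ModEq.dvd_iff hsq dvd_rfl).mp h1
      have := Nat.le_of_dvd hpp.pos h3
      nlinarith [hpp.two_le]
    · have h1 : p ∣ l := (Nat.ModEq.dvd_iff (geom_sum_modEq l (hmod p (hp p hpp hpm)))
        dvd_rfl).mp (hs ▸ hps.mul_left l)
      exact hpl ((Nat.prime_dvd_prime_iff_eq hpp hl).mp h1)
  · have h' : m ∣ (x - 1) * ∑ i ∈ Finset.range l, x ^ i := by
      rcases h with h | h
      · exact (dvd_mul_right _ _).trans h
      · exact h.2
    refine Nat.Coprime.dvd_of_dvd_mul_right (coprime_of_forall_prime fun p hpp hpm hps => ?_) h'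
    have h1 : p ∣ l := (Nat.ModEq.dvd_iff (geom_sum_modEq l (hmod p (hp p hpp hpm)))
        dvd_rfl).mp hps
    exact hlm ((Nat.prime_dvd_prime_iff_eq hpp hl).mp h1 ▸ hpm)

/-! ### Frobenius as a linear operator on powers of β. -/

/-- In a finite field extension, the base field consists of the fixed points of Frobenius. -/
theorem mem_range_algebraMap_of_pow_natCard_eq {K L : Type*} [Field K] [Field L] [Algebra K L]
    [Finite L] {x : L} (hx : x ^ Nat.card K = x) : x ∈ Set.range (algebraMap K L) := by
  have : Finite K := Finite.of_injective _ (algebraMap K L).injective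
  rw [IsGalois.mem_range_algebraMap_iff_fixed]
  intro f
  have := Fintype.ofFinite K
  obtain ⟨i, rfl⟩ := (FiniteField.bijective_frobeniusAlgEquivOfAlgebraic_pow K L).2 f
  simp only [AlgEquiv.coe_pow, FiniteField.coe_frobeniusAlgEquivOfAlgebraic]
  exact Function.iterate_fixed (by simpa using hx) _

theorem aeval_mem_of_forall_mem {R M : Type*} [CommRing R] [AddCommGroup M] [Module R M]
    (φ : Module.End R M) (V : Submodule R M) (hV : ∀ v ∈ V, φ v ∈ V) (f : R[X]) {v : M}
    (hv : v ∈ V) : aeval φ f v ∈ V := by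
  induction f using Polynomial.induction_on' generalizing v with
  | add f g hf hg => simpa using V.add_mem (hf hv) (hg hv)
  | monomial n a =>
    rw [aeval_monomial, Module.End.mul_apply, Module.algebraMap_end_apply]
    refine V.smul_mem _ ?_
    induction n generalizing v with
    | zero => simpa
    | succ n ih => rw [pow_succ, Module.End.mul_apply]; exact ih (hV v hv)

section Frobenius

variable {K L : Type*} [Field K] [Field L] [Algebra K L] [Fintype K]

theorem frobenius_pow_apply (i : ℕ) (x : L) :
    ((FiniteField.frobeniusAlgHom K L).toLinearMap ^ i) x = x ^ Fintype.card K ^ i := by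
  rw [Module.End.pow_apply]
  exact congrFun (pow_iterate (Fintype.card K) i) x

theorem frobenius_apply_pow_of_pow_eq {m : ℕ} {β : L} {Θ : K} (hΘ : β ^ m = algebraMap K L Θ)
    (i : ℕ) : (FiniteField.frobeniusAlgHom K L).toLinearMap (β ^ i) =
      Θ ^ (Fintype.card K * i / m) • β ^ (Fintype.card K * i % m) := by
  change (β ^ i) ^ Fintype.card K = _
  rw [Algebra.smul_def, map_pow, ← hΘ, ← pow_mul, ← pow_mul, ← pow_add, Nat.div_add_mod, mul_comm]

variable [Finite L]

/-- If `γ ^ m` lies in `K` and `m` satisfies the conditions below, then the `K[X]`-module generated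
by `γ`, with `X` acting as Frobenius, is annihilated by an irreducible polynomial. -/
theorem exists_irreducible_aeval_frobenius_eq_zero {m : ℕ} (hm : m ≠ 0)
    (hp : ∀ p : ℕ, p.Prime → p ∣ m → p ∣ Fintype.card K - 1)
    (h2 : 2 ∣ m → 4 ∣ Fintype.card K - 1) {γ : L} (hγ : γ ≠ 0)
    (hγm : γ ^ m ∈ Set.range (algebraMap K L)) :
    ∃ μ : K[X], Irreducible μ ∧
      aeval (FiniteField.frobeniusAlgHom K L).toLinearMap μ γ = 0 := by
  set q := Fintype.card K with hq
  have hq1 : 1 < q := Fintype.one_lt_card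
  have hK : ∀ y : K, y ≠ 0 → y ^ (q - 1) = 1 := fun y hy => FiniteField.pow_card_sub_one_eq_one y hy
  set ξ := γ ^ (q - 1) with hξ
  have hξm : ξ ^ m = 1 := by
    obtain ⟨z, hz⟩ := hγm
    have hz0 : z ≠ 0 := by
      rintro rfl
      rw [map_zero] at hz
      exact pow_ne_zero m hγ hz.symm
    rw [hξ, ← pow_mul, mul_comm, pow_mul, ← hz, ← map_pow, hK z hz0, map_one]
  set n := orderOf ξ with hn
  have hnm : n ∣ m := orderOf_dvd_of_pow_eq_one hξm
  have hn0 : n ≠ 0 := fun h => hm (Nat.eq_zero_of_zero_dvd (h ▸ hnm))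
  have hmod : ∀ e, n ∣ q ^ e - 1 ↔ (q : ZMod n) ^ e = 1 := fun e => by
    rw [← Nat.modEq_iff_dvd' (Nat.one_le_pow _ _ (by omega)), ← ZMod.natCast_eq_natCast_iff,
      eq_comm]
    simp
  have hcop : q.Coprime n := (coprime_of_forall_prime fun p hpp hpn hpq => by
    have h1 := hp p hpp (hpn.trans hnm)
    have h3 := (Nat.dvd_sub hpq h1)
    rw [Nat.sub_sub_self hq1.le] at h3
    exact hpp.one_lt.ne' (Nat.dvd_one.mp h3)).symm
  set r := orderOf (q : ZMod n) with hr
  have hr0 : 0 < r := orderOf_pos_iff.mpr <| isOfFinOrder_iff_pow_eq_one.mpr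
    ⟨n.totient, Nat.totient_pos.mpr (Nat.pos_of_ne_zero hn0), by
      simpa using (ZMod.natCast_eq_natCast_iff _ _ _).mpr (Nat.ModEq.pow_totient hcop)⟩
  have hnr : n ∣ q ^ r - 1 := (hmod r).mpr (pow_orderOf_eq_one _)
  -- Minimality of r forbids n ∣ q^(r/l) - 1; the lifting lemma, with x = q^(r/l), carries this over
  -- to q^r - 1.
  have hprime : ∀ l : ℕ, l.Prime → l ∣ r → ¬ (n * l ∣ q ^ r - 1 ∨ (¬ l ∣ n ∧ n ∣ q ^ r - 1)) := by
    intro l hl hlr h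
    obtain ⟨e, he⟩ := hlr
    have he0 : 0 < e := Nat.pos_of_ne_zero fun h => by simp [h] at he; omega
    have hsub : q - 1 ∣ q ^ e - 1 := by simpa using Nat.sub_dvd_pow_sub_pow q 1 e
    have h1 : n ∣ q ^ e - 1 := by
      refine dvd_sub_one_of_dvd_pow_sub_one_div (l := l) hl (Nat.one_le_pow _ _ (by omega))
        (fun p hpp hpn => (hp p hpp (hpn.trans hnm)).trans hsub)
        (fun h => (h2 (h.trans hnm)).trans hsub) ?_
      rwa [← pow_mul, mul_comm e l, ← he]
    refine pow_ne_one_of_lt_orderOf he0.ne' ?_ ((hmod e).mp h1)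
    rw [← hr, he]
    nlinarith [hl.two_le]
  have hln : ∀ l : ℕ, l.Prime → l ∣ r → l ∣ n := fun l hl hlr => by
    by_contra h
    exact hprime l hl hlr (Or.inr ⟨h, hnr⟩)
  obtain ⟨w, hw⟩ : γ ^ (q ^ r - 1) ∈ Set.range (algebraMap K L) := by
    apply mem_range_algebraMap_of_pow_natCard_eq
    rw [Nat.card_eq_fintype_card, ← hq, ← pow_sub_one_mul (by omega : q ≠ 0), ← pow_mul,
      mul_comm (q ^ r - 1), pow_mul, ← hξ, orderOf_dvd_iff_pow_eq_one.mp hnr, one_mul]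
  refine ⟨X ^ r - C w, X_pow_sub_C_irreducible_of_isSquare_neg_one hr0.ne' ?_ ?_, ?_⟩
  · intro h
    rw [FiniteField.isSquare_neg_one_iff, ← hq]
    have := h2 ((hln 2 Nat.prime_two h).trans hnm)
    omega
  -- If w = y^l, then ξ^((q^r-1)/l) = w^((q-1)/l) = y^(q-1) = 1, so n * l ∣ q^r - 1, against
  -- `hprime`.
  · intro l hl hlr y hy
    apply hprime l hl hlr
    left
    have hlq := hp l hl ((hln l hl hlr).trans hnm)
    have hlq' : l ∣ q ^ r - 1 := hlq.trans (by simpa using Nat.sub_dvd_pow_sub_pow q 1 r)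
    obtain ⟨e, he⟩ := hlq
    obtain ⟨u, hu⟩ := hlq'
    have hy0 : y ≠ 0 := by
      rintro rfl
      rw [zero_pow hl.ne_zero] at hy
      rw [← hy, map_zero] at hw
      exact pow_ne_zero _ hγ hw.symm
    rw [hu, mul_comm n l]
    refine mul_dvd_mul_left l (orderOf_dvd_of_pow_eq_one ?_)
    rw [hξ, he, ← pow_mul, mul_right_comm, ← hu, pow_mul, ← hw, ← hy, ← map_pow, ← pow_mul, ← he,
      hK y hy0, map_one]
  · simp only [map_sub, map_pow, aeval_X, aeval_C, LinearMap.sub_apply,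
      Module.algebraMap_end_apply, frobenius_pow_apply]
    rw [Algebra.smul_def, hw, ← hq, pow_sub_one_mul (pow_pos (by omega) r).ne', sub_self]

/-- Split the sum into its part v on the orbit of j and the rest. Both spans are Frobenius-stable
and independent, so f kills v; as v ≠ 0 lies in a simple module generated by β^j, f kills β^j too.
-/
theorem aeval_frobenius_pow_eq_zero {m : ℕ}
    (hp : ∀ p : ℕ, p.Prime → p ∣ m → p ∣ Fintype.card K - 1)
    (h2 : 2 ∣ m → 4 ∣ Fintype.card K - 1) {β : L} {Θ : K} (hΘ0 : Θ ≠ 0)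
    (hΘ : β ^ m = algebraMap K L Θ)
    (hli : LinearIndependent K fun i : Fin m => β ^ (i : ℕ))
    {y : Fin m → K} (hy : ∀ i, y i ≠ 0) {f : K[X]}
    (hf : aeval (FiniteField.frobeniusAlgHom K L).toLinearMap f (∑ i, y i • β ^ (i : ℕ)) = 0)
    (j : Fin m) : aeval (FiniteField.frobeniusAlgHom K L).toLinearMap f (β ^ (j : ℕ)) = 0 := by
  classical
  set φ := (FiniteField.frobeniusAlgHom K L).toLinearMap with hφ
  set q := Fintype.card K with hq
  have hq1 : 1 < q := Fintype.one_lt_card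
  have hm0 : 0 < m := j.pos
  have hβ : β ≠ 0 := by
    rintro rfl
    rw [zero_pow hm0.ne'] at hΘ
    exact hΘ0 ((map_eq_zero _).mp hΘ.symm)
  have hcop : q.Coprime m := (coprime_of_forall_prime fun p hpp hpm hpq => by
    have h3 := (Nat.dvd_sub hpq (hp p hpp hpm))
    rw [Nat.sub_sub_self hq1.le] at h3
    exact hpp.one_lt.ne' (Nat.dvd_one.mp h3)).symm
  let O : Set (Fin m) := {i | ∃ e : ℕ, (i : ℕ) ≡ q ^ e * j [MOD m]}
  have hO : ∀ i i' : Fin m, (i' : ℕ) = q * i % m → (i ∈ O ↔ i' ∈ O) := by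
    intro i i' hi
    have hi' : (i' : ℕ) ≡ q * i [MOD m] := by rw [hi]; exact Nat.mod_modEq _ _
    constructor
    · rintro ⟨e, he⟩
      refine ⟨e + 1, hi'.trans ?_⟩
      rw [pow_succ', mul_assoc]
      exact he.mul_left q
    · rintro ⟨e, he⟩
      -- q^(φ(m)-1) inverts q modulo m, so the complement of an orbit is stable as well.
      refine ⟨(m.totient - 1) + e, ?_⟩
      have h1 : q ^ (m.totient - 1) * (q * i) ≡ q ^ (m.totient - 1) * (q ^ e * j) [MOD m] :=
        (hi'.symm.trans he).mul_left _
      rw [← mul_assoc, ← mul_assoc, ← pow_add, pow_sub_one_mul (Nat.totient_pos.mpr hm0).ne'] at h1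
      have h3 := (Nat.ModEq.pow_totient hcop).mul_right (i : ℕ)
      rw [one_mul] at h3
      exact h3.symm.trans h1
  let V : Set (Fin m) → Submodule K L := fun s => Submodule.span K ((fun i : Fin m => β ^ (i : ℕ)) '' s)
  have hV : ∀ s : Set (Fin m), (∀ i ∈ s, ∀ i' : Fin m, (i' : ℕ) = q * i % m → i' ∈ s) →
      ∀ v ∈ V s, φ v ∈ V s := by
    intro s hs v hv
    have : V s ≤ (V s).comap φ := by
      refine Submodule.span_le.mpr ?_
      rintro _ ⟨i, hi, rfl⟩
      simp only [Submodule.comap_coe, Set.mem_preimage, SetLike.mem_coe]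
      rw [frobenius_apply_pow_of_pow_eq hΘ]
      exact (V s).smul_mem _ (Submodule.subset_span
        ⟨⟨q * i % m, Nat.mod_lt _ hm0⟩, hs i hi _ rfl, rfl⟩)
    exact this hv
  have hsplit : (∑ i, y i • β ^ (i : ℕ)) =
      (∑ i ∈ Finset.univ.filter (· ∈ O), y i • β ^ (i : ℕ)) +
        ∑ i ∈ Finset.univ.filter (¬ · ∈ O), y i • β ^ (i : ℕ) :=
    (Finset.sum_filter_add_sum_filter_not _ _ _).symm
  set v := ∑ i ∈ Finset.univ.filter (· ∈ O), y i • β ^ (i : ℕ) with hv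
  have hvO : v ∈ V O := (V O).sum_mem fun i hi =>
    (V O).smul_mem _ (Submodule.subset_span ⟨i, (Finset.mem_filter.mp hi).2, rfl⟩)
  have hvO' : ∑ i ∈ Finset.univ.filter (¬ · ∈ O), y i • β ^ (i : ℕ) ∈ V Oᶜ :=
    (V Oᶜ).sum_mem fun i hi =>
      (V Oᶜ).smul_mem _ (Submodule.subset_span ⟨i, (Finset.mem_filter.mp hi).2, rfl⟩)
  have hfv : aeval φ f v = 0 := by
    rw [hsplit, map_add] at hf
    have h1 := aeval_mem_of_forall_mem φ (V O) (hV O fun i hi i' h => (hO i i' h).mp hi) f hvO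
    have h3 := aeval_mem_of_forall_mem φ (V Oᶜ)
      (hV Oᶜ fun i hi i' h => fun h' => hi ((hO i i' h).mpr h')) f hvO'
    rw [eq_neg_of_add_eq_zero_right hf] at h3
    exact (Submodule.disjoint_def.mp (hli.disjoint_span_image disjoint_compl_right)) _ h1
      (by simpa using (V Oᶜ).neg_mem h3)
  have hv0 : v ≠ 0 := by
    intro h0
    exact hy j (linearIndependent_iff'.mp hli _ y h0 j
      (Finset.mem_filter.mpr ⟨Finset.mem_univ _, 0, by simp [Nat.ModEq.refl]⟩))
  obtain ⟨h, hh⟩ : ∃ h : K[X], aeval φ h (β ^ (j : ℕ)) = v := by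
    let ev : K[X] →ₗ[K] L :=
      (LinearMap.applyₗ (β ^ (j : ℕ))).comp (aeval φ).toLinearMap
    suffices V O ≤ LinearMap.range ev from this hvO
    refine Submodule.span_le.mpr ?_
    rintro _ ⟨i, ⟨e, he⟩, rfl⟩
    refine ⟨C ((Θ ^ (q ^ e * j / m))⁻¹) * X ^ e, ?_⟩
    have hmod : (i : ℕ) = q ^ e * j % m := by rw [← he, Nat.mod_eq_of_lt i.2]
    simp only [ev, LinearMap.comp_apply, AlgHom.toLinearMap_apply, LinearMap.applyₗ_apply_apply,
      map_mul, aeval_C, map_pow, aeval_X, Module.End.mul_apply, Module.algebraMap_end_apply]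
    rw [frobenius_pow_apply, inv_smul_eq_iff₀ (pow_ne_zero _ hΘ0), Algebra.smul_def, map_pow, ← hΘ,
      hmod, ← pow_mul, ← pow_mul, ← pow_add, Nat.div_add_mod, mul_comm]
  obtain ⟨μ, hμ, hμj⟩ := exists_irreducible_aeval_frobenius_eq_zero (L := L) hm0.ne' hp h2
    (pow_ne_zero (j : ℕ) hβ) ⟨Θ ^ (j : ℕ), by rw [map_pow, ← hΘ, ← pow_mul, ← pow_mul, mul_comm]⟩
  have hzero : ∀ a b : K[X], aeval φ b (β ^ (j : ℕ)) = 0 → aeval φ (a * b) (β ^ (j : ℕ)) = 0 := by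
    intro a b hb
    rw [map_mul, Module.End.mul_apply, hb, map_zero]
  have hndvd : ¬ μ ∣ h := by
    rintro ⟨g, rfl⟩
    exact hv0 (by rw [← hh, mul_comm, hzero g μ hμj])
  -- Bézout: both μ and f * h kill β^j, hence so does f = f(aμ + bh).
  obtain ⟨a, b, hab⟩ := (hμ.coprime_iff_not_dvd).mpr hndvd
  have hf' : f = (f * a) * μ + b * (f * h) := by
    calc f = f * (a * μ + b * h) := by rw [hab, mul_one]
      _ = _ := by ring
  have hfh : aeval φ (f * h) (β ^ (j : ℕ)) = 0 := by
    rw [map_mul, Module.End.mul_apply, hh, hfv]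
  rw [hf', map_add, LinearMap.add_apply, hzero _ _ hμj, hzero _ _ hfh, add_zero]

/-- A linear relation among the conjugates is a polynomial of degree < m in Frobenius killing the
element. It then kills a basis, so the minimal polynomial X^m - 1 of Frobenius divides it. -/
theorem isNormalElement_of_sum_pow
    (hp : ∀ p : ℕ, p.Prime → p ∣ Module.finrank K L → p ∣ Fintype.card K - 1)
    (h2 : 2 ∣ Module.finrank K L → 4 ∣ Fintype.card K - 1) {β : L} {Θ : K} (hΘ0 : Θ ≠ 0)
    (hΘ : β ^ Module.finrank K L = algebraMap K L Θ)
    (hli : LinearIndependent K fun i : Fin (Module.finrank K L) => β ^ (i : ℕ))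
    {y : Fin (Module.finrank K L) → K} (hy : ∀ i, y i ≠ 0) :
    IsNormalElement K L (∑ i, y i • β ^ (i : ℕ)) := by
  unfold IsNormalElement
  rw [Fintype.linearIndependent_iff]
  intro c hc
  set f : K[X] := ∑ i : Fin (Module.finrank K L), monomial (i : ℕ) (c i) with hf
  have hdeg : f.degree < (Module.finrank K L : ℕ) := by
    refine (degree_sum_le _ _).trans_lt ((Finset.sup_lt_iff (WithBot.bot_lt_coe _)).mpr ?_)
    intro i _
    exact (degree_monomial_le _ _).trans_lt (by exact_mod_cast i.2)
  have hf0 : aeval (FiniteField.frobeniusAlgHom K L).toLinearMap f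
      (∑ i, y i • β ^ (i : ℕ)) = 0 := by
    generalize (∑ i, y i • β ^ (i : ℕ)) = α at hc ⊢
    rw [← hc, hf, map_sum, LinearMap.sum_apply]
    refine Finset.sum_congr rfl fun i _ => ?_
    rw [aeval_monomial, Module.End.mul_apply, Module.algebraMap_end_apply, frobenius_pow_apply,
      Nat.card_eq_fintype_card]
  have hall := aeval_frobenius_pow_eq_zero hp h2 hΘ0 hΘ hli hy hf0
  have hzero : aeval (FiniteField.frobeniusAlgHom K L).toLinearMap f = 0 := by
    have : Nonempty (Fin (Module.finrank K L)) := ⟨⟨0, Module.finrank_pos⟩⟩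
    refine (basisOfLinearIndependentOfCardEqFinrank hli (by simp)).ext fun j => ?_
    simpa using hall j
  have hdvd := minpoly.dvd K _ hzero
  rw [FiniteField.minpoly_frobeniusAlgHom] at hdvd
  have hf00 : f = 0 := by
    by_contra hne
    have := degree_le_of_dvd hdvd hne
    rw [← C_1, degree_X_pow_sub_C Module.finrank_pos] at this
    exact absurd hdeg (not_lt.mpr this)
  intro i
  have := congrArg (fun p => coeff p (i : ℕ)) hf00
  simpa [hf, finsetSum_coeff, coeff_monomial, Fin.val_inj] using this

end Frobenius

/-! ### Normality of linear fractional expressions in β. -/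

theorem isNormalElement_linearFractional {K L : Type*} [Field K] [Field L] [Algebra K L] [Finite L]
    [Fintype K] (hp : ∀ p : ℕ, p.Prime → p ∣ Module.finrank K L → p ∣ Fintype.card K - 1)
    (h2 : 2 ∣ Module.finrank K L → 4 ∣ Fintype.card K - 1) {β : L} {Θ : K} (hΘ0 : Θ ≠ 0)
    (hΘ : β ^ Module.finrank K L = algebraMap K L Θ)
    (hli : LinearIndependent K fun i : Fin (Module.finrank K L) => β ^ (i : ℕ))
    {a b c D : K} (hc : c ≠ 0) (hD : D ≠ 0) (hdet : b + a * D ≠ 0)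
    (hβ : β ≠ algebraMap K L D)
    (htr : a * Θ + b * D ^ (Module.finrank K L - 1) ≠ 0) :
    IsNormalElement K L ((algebraMap K L a * β + algebraMap K L b) /
      (algebraMap K L c * (β - algebraMap K L D))) := by
  have hm : 0 < Module.finrank K L := Module.finrank_pos
  have hgeom := geom_sum₂_mul β (algebraMap K L D) (Module.finrank K L)
  rw [Finset.sum_range, hΘ, ← map_pow, ← map_sub] at hgeom
  have hΔ : Θ - D ^ Module.finrank K L ≠ 0 := by
    intro h
    rw [h, map_zero] at hgeom
    have h0 := (mul_eq_zero.mp hgeom).resolve_right (sub_ne_zero.mpr hβ)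
    have := Fintype.linearIndependent_iff.mp hli
      (fun i => D ^ (Module.finrank K L - 1 - (i : ℕ))) (by
        rw [← h0]
        refine Finset.sum_congr rfl fun i _ => ?_
        rw [Algebra.smul_def, map_pow, mul_comm]) ⟨0, hm⟩
    exact pow_ne_zero _ hD this
  set m := Module.finrank K L with hm_def
  set Δ := Θ - D ^ m with hΔ_def
  -- Coordinates of a/c + ((b + aD)/c)/(β - D), where 1/(β - D) = ∑ D^(m-1-j) β^j / (Θ - D^m).
  let y : Fin m → K := fun j =>
    (b + a * D) * D ^ (m - 1 - (j : ℕ)) / (c * Δ) + if (j : ℕ) = 0 then a / c else 0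
  have hy : ∀ j, y j ≠ 0 := by
    intro j
    by_cases hj : (j : ℕ) = 0
    · have : y j = (a * Θ + b * D ^ (m - 1)) / (c * Δ) := by
        simp only [y, hj, if_true, Nat.sub_zero]
        have hDm : D ^ m = D * D ^ (m - 1) := by rw [mul_pow_sub_one hm.ne']
        field_simp
        rw [hΔ_def, hDm]
        ring
      rw [this]
      exact div_ne_zero htr (mul_ne_zero hc hΔ)
    · simp only [y, hj, if_false, add_zero]
      exact div_ne_zero (mul_ne_zero hdet (pow_ne_zero _ hD)) (mul_ne_zero hc hΔ)
  have hsum : ∑ j, y j • β ^ (j : ℕ) = (algebraMap K L a * β + algebraMap K L b) /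
      (algebraMap K L c * (β - algebraMap K L D)) := by
    have h1 : ∑ j, y j • β ^ (j : ℕ) =
        algebraMap K L ((b + a * D) / (c * Δ)) *
          (∑ j : Fin m, β ^ (j : ℕ) * algebraMap K L D ^ (m - 1 - (j : ℕ))) +
          algebraMap K L (a / c) := by
      have h0 : ∑ j : Fin m, (if (j : ℕ) = 0 then a / c else 0) • β ^ (j : ℕ) =
          algebraMap K L (a / c) := by
        rw [Finset.sum_eq_single ⟨0, hm⟩]
        · simp [Algebra.smul_def]
        · intro j _ hj
          have : (j : ℕ) ≠ 0 := fun h => hj (Fin.ext h)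
          simp [this]
        · simp
      rw [← h0, Finset.mul_sum, ← Finset.sum_add_distrib]
      refine Finset.sum_congr rfl fun j _ => ?_
      simp only [y, add_smul]
      congr 1
      rw [Algebra.smul_def, ← map_pow, mul_comm (β ^ (j : ℕ)), ← mul_assoc, ← map_mul]
      congr 2
      ring
    have hc' : algebraMap K L c ≠ 0 := (_root_.map_ne_zero _).mpr hc
    have hΔ' : algebraMap K L Δ ≠ 0 := (_root_.map_ne_zero _).mpr hΔ
    have hβ' : β - algebraMap K L D ≠ 0 := sub_ne_zero.mpr hβ
    rw [h1, eq_div_of_mul_eq hβ' hgeom]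
    simp only [map_div₀, map_add, map_mul]
    field_simp
    ring
  rw [← hsum]
  exact isNormalElement_of_sum_pow hp h2 hΘ0 hΘ hli hy

/-- Linear fractional transforms of an `N`-th root of `θ`, where `X ^ N - θ` is irreducible. -/
theorem isCompletelyNormalElement_linearFractional {F L : Type*} [Field F] [Finite F] [Field L]
    [Algebra F L] [FiniteDimensional F L]
    (hp : ∀ p : ℕ, p.Prime → p ∣ Module.finrank F L → p ∣ Nat.card F - 1)
    (h2 : 2 ∣ Module.finrank F L → 4 ∣ Nat.card F - 1) {β : L} {θ : F}
    (hθ0 : θ ≠ 0) (hθ : ∀ p : ℕ, p.Prime → p ∣ Module.finrank F L → ∀ y : F, y ^ p ≠ θ)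
    (hβ : β ^ Module.finrank F L = algebraMap F L θ)
    {a b c D : F} (hc : c ≠ 0) (hD : D ≠ 0) (hdet : b + a * D ≠ 0)
    (hθD : θ ≠ D ^ Module.finrank F L)
    (htr : a * θ + b * D ^ (Module.finrank F L - 1) ≠ 0) :
    IsCompletelyNormalElement F L ((algebraMap F L a * β + algebraMap F L b) /
      (algebraMap F L c * (β - algebraMap F L D))) := by
  have hfinL : Finite L := Module.finite_of_finite F
  intro E
  set s := Module.finrank F E with hs
  set m := Module.finrank E L with hm
  have hsm : s * m = Module.finrank F L := Module.finrank_mul_finrank F E L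
  have hs0 : 0 < s := Module.finrank_pos
  have hm0 : 0 < m := Module.finrank_pos
  rw [← hsm] at hp h2 hθ hβ hθD htr
  have hFintype : Fintype F := Fintype.ofFinite F
  have hsq : 2 ∣ s * m → IsSquare (-1 : F) := fun h => by
    rw [FiniteField.isSquare_neg_one_iff, ← Nat.card_eq_fintype_card]
    have := h2 h
    have : 1 < Nat.card F := Finite.one_lt_card
    omega
  have hirr : ∀ n : ℕ, n ≠ 0 → n ∣ s * m → Irreducible (X ^ n - C θ) := fun n hn0 hn =>
    X_pow_sub_C_irreducible_of_isSquare_neg_one hn0 (fun h => hsq (h.trans hn))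
      fun p hpp hpn => hθ p hpp (hpn.trans hn)
  have hdeg : ∀ (n : ℕ) (x : L), n ≠ 0 → n ∣ s * m → x ^ n = algebraMap F L θ →
      (minpoly F x).natDegree = n := fun n x hn0 hn hx => by
    rw [← minpoly.eq_of_irreducible_of_monic (hirr n hn0 hn) (by simp [hx])
      (monic_X_pow_sub_C θ hn0), natDegree_X_pow_sub_C]
  have hcardE : Nat.card E = Nat.card F ^ s := Module.natCard_eq_pow_finrank
  obtain ⟨Θ, hΘ⟩ : β ^ m ∈ Set.range (algebraMap E L) := by
    apply mem_range_algebraMap_of_pow_natCard_eq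
    -- β^m is a root of the irreducible X^s - θ, so F(β^m) has as many elements as E and its
    -- Frobenius fixes β^m.
    have h1 : Module.finrank F (IntermediateField.adjoin F {β ^ m}) = s := by
      rw [IntermediateField.adjoin.finrank (IsIntegral.of_finite F _)]
      exact hdeg s _ hs0.ne' (dvd_mul_right _ _) (by rw [← pow_mul, mul_comm, hβ])
    have h3 : Nat.card (IntermediateField.adjoin F {β ^ m}) = Nat.card F ^ s := by
      rw [← h1]; exact Module.natCard_eq_pow_finrank
    have : Fintype (IntermediateField.adjoin F {β ^ m}) := Fintype.ofFinite _
    have h4 := FiniteField.pow_card (IntermediateField.AdjoinSimple.gen F (β ^ m))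
    rw [← Nat.card_eq_fintype_card, h3, ← hcardE] at h4
    simpa using congrArg (algebraMap _ L) h4
  have htop : IntermediateField.adjoin E {β} = ⊤ := by
    apply IntermediateField.adjoin_eq_top_of_adjoin_eq_top F
    rw [Field.primitive_element_iff_minpoly_natDegree_eq, ← hsm]
    exact hdeg _ _ (mul_pos hs0 hm0).ne' dvd_rfl hβ
  have hli : LinearIndependent E fun i : Fin m => β ^ (i : ℕ) := by
    have h1 := linearIndependent_pow (K := E) β
    rwa [(Field.primitive_element_iff_minpoly_natDegree_eq E β).mp htop] at h1
  have hΘs : Θ ^ s = algebraMap F E θ := by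
    apply (algebraMap E L).injective
    rw [map_pow, hΘ, ← pow_mul, mul_comm, hβ, ← IsScalarTower.algebraMap_apply]
  have : Fintype E := Fintype.ofFinite E
  have hsub : Nat.card F - 1 ∣ Fintype.card E - 1 := by
    rw [← Nat.card_eq_fintype_card, hcardE]
    simpa using Nat.sub_dvd_pow_sub_pow (Nat.card F) 1 s
  have hEinj : ∀ x : F, x ≠ 0 → algebraMap F E x ≠ 0 := fun x hx => (_root_.map_ne_zero _).mpr hx
  have key := isNormalElement_linearFractional (K := E) (L := L) (β := β) (Θ := Θ)
    (a := algebraMap F E a) (b := algebraMap F E b) (c := algebraMap F E c)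
    (D := algebraMap F E D)
    (fun p hpp hpm => (hp p hpp (hpm.mul_left s)).trans hsub)
    (fun h => (h2 (h.mul_left s)).trans hsub)
    (fun h => hEinj θ hθ0 (by rw [← hΘs, h, zero_pow hs0.ne'])) hΘ.symm hli (hEinj c hc)
    (hEinj D hD) (by rw [← map_mul, ← map_add]; exact hEinj _ hdet) ?_ ?_
  · simpa only [← IsScalarTower.algebraMap_apply] using key
  · intro h
    apply hθD
    apply (algebraMap F L).injective
    rw [← hβ, h, ← IsScalarTower.algebraMap_apply, map_pow]
  · intro h
    rw [← hm] at h
    by_cases ha : a = 0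
    · have hb : b ≠ 0 := by rintro rfl; simp [ha] at hdet
      rw [ha, map_zero, zero_mul, zero_add] at h
      exact mul_ne_zero (hEinj b hb) (pow_ne_zero _ (hEinj D hD)) h
    · have hz : Θ = algebraMap F E (-(b * D ^ (m - 1)) / a) := by
        have := hEinj a ha
        rw [map_div₀, map_neg, map_mul, map_pow, eq_div_iff this]
        linear_combination h
      have hz' : (-(b * D ^ (m - 1)) / a) ^ s = θ := by
        apply (algebraMap F E).injective
        rw [map_pow, ← hz, hΘs]
      by_cases hs1 : s = 1
      · rw [hs1, pow_one, div_eq_iff ha] at hz'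
        apply htr
        rw [hs1, one_mul]
        linear_combination -hz'
      · obtain ⟨p, hpp, u, hu⟩ := Nat.exists_prime_and_dvd hs1
        rw [hu, mul_comm p u, pow_mul] at hz'
        exact hθ p hpp ((Dvd.intro u hu.symm).mul_right m) _ hz'

/-! ### The transforms P and the closed form of the iterates. -/

section Transform

variable {F : Type*} [Field F] (σ : Matrix.GeneralLinearGroup (Fin 2) F)

theorem aeval_P {L : Type*} [Field L] [Algebra F L] (f : F[X]) {x : L}
    (hx : algebraMap F L (σ 1 0) * x + algebraMap F L (σ 1 1) ≠ 0) :
    aeval x (P σ f) = (algebraMap F L (σ 1 0) * x + algebraMap F L (σ 1 1)) ^ f.natDegree *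
      aeval ((algebraMap F L (σ 0 0) * x + algebraMap F L (σ 0 1)) /
        (algebraMap F L (σ 1 0) * x + algebraMap F L (σ 1 1))) f := by
  rw [P, map_sum, aeval_eq_sum_range, Finset.mul_sum]
  refine Finset.sum_congr rfl fun i hi => ?_
  have hi' : i ≤ f.natDegree := Nat.lt_succ_iff.mp (Finset.mem_range.mp hi)
  simp only [map_mul, map_pow, map_add, aeval_C, aeval_X, Algebra.smul_def]
  rw [div_pow, pow_sub₀ _ hx hi']
  field_simp

theorem aeval_P_of_eq_zero {L : Type*} [Field L] [Algebra F L] (f : F[X]) {x : L}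
    (hx : algebraMap F L (σ 1 0) * x + algebraMap F L (σ 1 1) = 0) :
    aeval x (P σ f) = algebraMap F L f.leadingCoeff *
      (algebraMap F L (σ 0 0) * x + algebraMap F L (σ 0 1)) ^ f.natDegree := by
  rw [P, map_sum, Finset.sum_range_succ, Finset.sum_eq_zero, zero_add]
  · simp
  · intro i hi
    have : f.natDegree - i ≠ 0 := by
      have := Finset.mem_range.mp hi
      omega
    simp [hx, this]

theorem natDegree_P_le (f : F[X]) : (P σ f).natDegree ≤ f.natDegree := by
  refine natDegree_sum_le_of_forall_le _ _ fun i hi => ?_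
  have hi' : i ≤ f.natDegree := Nat.lt_succ_iff.mp (Finset.mem_range.mp hi)
  have h1 : (C (f.coeff i) * (C (σ 0 0) * X + C (σ 0 1)) ^ i).natDegree ≤ i :=
    (natDegree_C_mul_le _ _).trans ((natDegree_pow_le_of_le i natDegree_linear_le).trans (by simp))
  have h3 : ((C (σ 1 0) * X + C (σ 1 1)) ^ (f.natDegree - i)).natDegree ≤ f.natDegree - i :=
    (natDegree_pow_le_of_le _ natDegree_linear_le).trans (by simp)
  exact (natDegree_mul_le_of_le h1 h3).trans (by omega)

/-- Shows that the degree drops exactly when a/c, the image of ∞, is a root of f. -/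
theorem coeff_P_natDegree (hc : σ 1 0 ≠ 0) (f : F[X]) :
    (P σ f).coeff f.natDegree = σ 1 0 ^ f.natDegree * f.eval (σ 0 0 / σ 1 0) := by
  rw [P, finsetSum_coeff, eval_eq_sum_range, Finset.mul_sum]
  refine Finset.sum_congr rfl fun i hi => ?_
  have hi' : i ≤ f.natDegree := Nat.lt_succ_iff.mp (Finset.mem_range.mp hi)
  have hlin : ∀ (u v : F) (n : ℕ), ((C u * X + C v) ^ n).coeff n = u ^ n := fun u v n => by
    have := coeff_pow_of_natDegree_le (m := n) (natDegree_linear_le (a := u) (b := v))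
    rw [mul_one] at this
    simp [this]
  have hdeg : ∀ (u v : F) (n : ℕ), ((C u * X + C v) ^ n).natDegree ≤ n := fun u v n =>
    (natDegree_pow_le_of_le n natDegree_linear_le).trans (by simp)
  have h1 := coeff_mul_add_eq_of_natDegree_le (hdeg (σ 0 0) (σ 0 1) i)
    (hdeg (σ 1 0) (σ 1 1) (f.natDegree - i))
  rw [Nat.add_sub_cancel' hi', hlin, hlin] at h1
  rw [mul_assoc, coeff_C_mul, h1, div_pow, pow_sub₀ _ hc hi']
  field_simp

theorem natDegree_P_eq (hc : σ 1 0 ≠ 0) {f : F[X]} (hf : f.eval (σ 0 0 / σ 1 0) ≠ 0) :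
    (P σ f).natDegree = f.natDegree := by
  refine (natDegree_P_le σ f).antisymm (le_natDegree_of_ne_zero ?_)
  rw [coeff_P_natDegree σ hc]
  exact mul_ne_zero (pow_ne_zero _ hc) hf

theorem mul_inv_entries (L : Type*) [Field L] [Algebra F L] :
    (algebraMap F L (σ 0 0) * algebraMap F L (σ⁻¹ 0 0) +
      algebraMap F L (σ 0 1) * algebraMap F L (σ⁻¹ 1 0) = 1) ∧
    (algebraMap F L (σ 0 0) * algebraMap F L (σ⁻¹ 0 1) +
      algebraMap F L (σ 0 1) * algebraMap F L (σ⁻¹ 1 1) = 0) ∧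
    (algebraMap F L (σ 1 0) * algebraMap F L (σ⁻¹ 0 0) +
      algebraMap F L (σ 1 1) * algebraMap F L (σ⁻¹ 1 0) = 0) ∧
    (algebraMap F L (σ 1 0) * algebraMap F L (σ⁻¹ 0 1) +
      algebraMap F L (σ 1 1) * algebraMap F L (σ⁻¹ 1 1) = 1) := by
  have h : ((σ : Matrix (Fin 2) (Fin 2) F) * ((σ⁻¹ : Matrix.GeneralLinearGroup (Fin 2) F) :
      Matrix (Fin 2) (Fin 2) F)) = 1 := by
    rw [← Units.val_mul, mul_inv_cancel, Units.val_one]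
  simp only [← map_mul, ← map_add]
  refine ⟨?_, ?_, ?_, ?_⟩
  · rw [← map_one (algebraMap F L)]; congr 1
    simpa [Matrix.mul_apply, Fin.sum_univ_two] using congrFun (congrFun h 0) 0
  · rw [← map_zero (algebraMap F L)]; congr 1
    simpa [Matrix.mul_apply, Fin.sum_univ_two] using congrFun (congrFun h 0) 1
  · rw [← map_zero (algebraMap F L)]; congr 1
    simpa [Matrix.mul_apply, Fin.sum_univ_two] using congrFun (congrFun h 1) 0
  · rw [← map_one (algebraMap F L)]; congr 1
    simpa [Matrix.mul_apply, Fin.sum_univ_two] using congrFun (congrFun h 1) 1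

/-- The linear fractional transformations of `σ⁻¹` and `σ` are inverse to each other. -/
theorem linearFractional_inv {L : Type*} [Field L] [Algebra F L] {x y : L}
    (hx : algebraMap F L (σ⁻¹ 1 0) * x + algebraMap F L (σ⁻¹ 1 1) ≠ 0)
    (hy : y = (algebraMap F L (σ⁻¹ 0 0) * x + algebraMap F L (σ⁻¹ 0 1)) /
      (algebraMap F L (σ⁻¹ 1 0) * x + algebraMap F L (σ⁻¹ 1 1))) :
    algebraMap F L (σ 1 0) * y + algebraMap F L (σ 1 1) =
      (algebraMap F L (σ⁻¹ 1 0) * x + algebraMap F L (σ⁻¹ 1 1))⁻¹ ∧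
    algebraMap F L (σ 0 0) * y + algebraMap F L (σ 0 1) =
      x * (algebraMap F L (σ⁻¹ 1 0) * x + algebraMap F L (σ⁻¹ 1 1))⁻¹ := by
  obtain ⟨h1, h2, h3, h4⟩ := mul_inv_entries σ L
  have hy' := (eq_div_iff hx).mp hy
  constructor
  · apply eq_inv_of_mul_eq_one_left
    linear_combination algebraMap F L (σ 1 0) * hy' + x * h3 + h4
  · rw [eq_mul_inv_iff_mul_eq₀ hx]
    linear_combination algebraMap F L (σ 0 0) * hy' + x * h1 + h2

/-- Evaluate at the generic point `RatFunc.X`, where no denominator vanishes; equal degrees make the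
power factors cancel. -/
theorem P_inv_P (hc : σ⁻¹ 1 0 ≠ 0) {f : F[X]} (hf : (P σ f).natDegree = f.natDegree) :
    P σ⁻¹ (P σ f) = f := by
  apply RatFunc.algebraMap_injective F
  have haeval : ∀ p : F[X], algebraMap F[X] (RatFunc F) p = aeval (RatFunc.X : RatFunc F) p :=
    fun p => by
      rw [← RatFunc.algebraMap_X, aeval_algebraMap_apply, aeval_X_left_apply]
  have hx : algebraMap F (RatFunc F) (σ⁻¹ 1 0) * RatFunc.X + algebraMap F (RatFunc F) (σ⁻¹ 1 1) ≠
      0 := by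
    have h1 : C (σ⁻¹ 1 0) * X + C (σ⁻¹ 1 1) ≠ 0 := fun h => hc (by
      simpa using congrArg (fun p => coeff p 1) h)
    have h3 := haeval (C (σ⁻¹ 1 0) * X + C (σ⁻¹ 1 1))
    simp only [map_add (aeval _), map_mul (aeval _), aeval_C, aeval_X] at h3
    rw [← h3]
    exact (map_ne_zero_iff _ (RatFunc.algebraMap_injective F)).mpr h1
  obtain ⟨h1, h3⟩ := linearFractional_inv σ hx rfl
  rw [haeval, haeval, aeval_P σ⁻¹ _ hx, aeval_P σ _ (by rw [h1]; exact inv_ne_zero hx), h1, h3, hf,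
    ← mul_assoc, ← mul_pow, mul_inv_cancel₀ hx, one_pow, one_mul,
    mul_div_cancel_right₀ _ (inv_ne_zero hx)]

theorem P_X_sub_C (A : F) :
    P σ (X - C A) = C (σ 0 0 - σ 1 0 * A) * X + C (σ 0 1 - σ 1 1 * A) := by
  rw [P, natDegree_X_sub_C, Finset.sum_range_succ, Finset.sum_range_one]
  simp
  ring

theorem S_C_mul_X_pow_sub_C (t N : ℕ) (u θ : F) :
    S t (C u * (X ^ N - C θ)) = C u * (X ^ (N * t) - C θ) := by
  simp [S, ← pow_mul, mul_comm]

theorem natDegree_C_mul_X_pow_sub_C {u : F} (hu : u ≠ 0) (N : ℕ) (θ : F) :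
    (C u * (X ^ N - C θ)).natDegree = N := by
  rw [natDegree_C_mul hu, natDegree_X_pow_sub_C]

theorem gSeq_X_sub_C (hc : σ 1 0 ≠ 0) (hc' : σ⁻¹ 1 0 ≠ 0) {A θ : F} {t : ℕ}
    (hu : σ 0 0 - σ 1 0 * A ≠ 0) (hθ : (σ 0 0 - σ 1 0 * A) * θ = σ 1 1 * A - σ 0 1)
    (hD : ∀ k, (σ⁻¹ 0 0 / σ⁻¹ 1 0) ^ t ^ k ≠ θ) (k : ℕ) :
    gSeq σ t (X - C A) k = P σ⁻¹ (C (σ 0 0 - σ 1 0 * A) * (X ^ t ^ k - C θ)) := by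
  induction k with
  | zero =>
    have h1 : P σ (X - C A) = C (σ 0 0 - σ 1 0 * A) * (X ^ t ^ 0 - C θ) := by
      rw [P_X_sub_C, pow_zero, pow_one, mul_sub, ← C_mul, hθ, sub_eq_add_neg (_ * X), ← C_neg,
        neg_sub]
    rw [← h1, P_inv_P σ hc' (by rw [h1, natDegree_C_mul_X_pow_sub_C hu, natDegree_X_sub_C, pow_zero])]
    rfl
  | succ k ih =>
    have hne : (C (σ 0 0 - σ 1 0 * A) * (X ^ t ^ k - C θ)).eval (σ⁻¹ 0 0 / σ⁻¹ 1 0) ≠ 0 := by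
      simpa [hu, sub_eq_zero] using hD k
    have h1 := P_inv_P σ⁻¹ (by rwa [inv_inv]) (natDegree_P_eq σ⁻¹ hc' hne)
    rw [inv_inv] at h1
    rw [gSeq, R, ih, h1, S_C_mul_X_pow_sub_C, pow_succ]

end Transform

/-- Roots of the transform are σ-images of N-th roots β of θ. Since α and β generate the same field,
α has degree N, which gives irreducibility. -/
theorem isCompletelyNormalPoly_P_inv {F : Type*} [Field F] [Finite F]
    (σ : Matrix.GeneralLinearGroup (Fin 2) F) (hc : σ 1 0 ≠ 0) (hc' : σ⁻¹ 1 0 ≠ 0)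
    {D : F} (hD : D ≠ 0) (hcD : σ 1 1 = -(σ 1 0 * D)) (hD' : σ⁻¹ 0 0 / σ⁻¹ 1 0 = D)
    (hdet : σ 0 1 + σ 0 0 * D ≠ 0) {N : ℕ} (hN : N ≠ 0)
    (hp : ∀ p : ℕ, p.Prime → p ∣ N → p ∣ Nat.card F - 1) (h2 : 2 ∣ N → 4 ∣ Nat.card F - 1)
    {u θ : F} (hu : u ≠ 0) (hθ0 : θ ≠ 0) (hθ : ∀ p : ℕ, p.Prime → p ∣ N → ∀ y : F, y ^ p ≠ θ)
    (hθD : θ ≠ D ^ N) (htr : σ 0 0 * θ + σ 0 1 * D ^ (N - 1) ≠ 0) :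
    IsCompletelyNormalPoly (P σ⁻¹ (C u * (X ^ N - C θ))) := by
  have hdegN := natDegree_C_mul_X_pow_sub_C hu N θ
  have hdeg : (P σ⁻¹ (C u * (X ^ N - C θ))).natDegree = N := by
    rw [natDegree_P_eq σ⁻¹ hc', hdegN]
    rw [hD']
    simpa [hu, sub_eq_zero] using hθD.symm
  have : Fintype F := Fintype.ofFinite F
  have hirr : Irreducible (X ^ N - C θ) := by
    refine X_pow_sub_C_irreducible_of_isSquare_neg_one hN (fun h => ?_) hθ
    rw [FiniteField.isSquare_neg_one_iff, ← Nat.card_eq_fintype_card]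
    have := h2 h
    have : 1 < Nat.card F := Finite.one_lt_card
    omega
  have hden : ∀ (L : Type _) [Field L] [Algebra F L] (β : L),
      algebraMap F L (σ 1 0) * β + algebraMap F L (σ 1 1) =
        algebraMap F L (σ 1 0) * (β - algebraMap F L D) := fun L _ _ β => by
    rw [hcD, map_neg, map_mul]; ring
  constructor
  · have : Fact (Irreducible (X ^ N - C θ)) := ⟨hirr⟩
    let L := AdjoinRoot (X ^ N - C θ)
    let β : L := AdjoinRoot.root (X ^ N - C θ)
    have hβN : β ^ N = algebraMap F L θ := root_X_pow_sub_C_pow N θ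
    let pb := AdjoinRoot.powerBasis hirr.ne_zero
    have hfd : FiniteDimensional F L := pb.finite
    have hfin : Module.finrank F L = N := by
      rw [pb.finrank, AdjoinRoot.powerBasis_dim, natDegree_X_pow_sub_C]
    have hβtop : IntermediateField.adjoin F {β} = ⊤ := by
      rw [Field.primitive_element_iff_minpoly_natDegree_eq, hfin,
        ← minpoly.eq_of_irreducible_of_monic hirr (by simp [hβN]) (monic_X_pow_sub_C θ hN),
        natDegree_X_pow_sub_C]
    have hβD : algebraMap F L (σ 1 0) * β + algebraMap F L (σ 1 1) ≠ 0 := by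
      rw [hden L]
      refine mul_ne_zero ((_root_.map_ne_zero _).mpr hc) (sub_ne_zero.mpr fun h => hθD ?_)
      apply (algebraMap F L).injective
      rw [← hβN, h, map_pow]
    have key := linearFractional_inv σ⁻¹ (x := β) (by rwa [inv_inv]) rfl
    rw [inv_inv] at key
    set α : L := (algebraMap F L (σ 0 0) * β + algebraMap F L (σ 0 1)) /
      (algebraMap F L (σ 1 0) * β + algebraMap F L (σ 1 1)) with hα
    obtain ⟨h1, h3⟩ := key
    have hne : algebraMap F L (σ⁻¹ 1 0) * α + algebraMap F L (σ⁻¹ 1 1) ≠ 0 := by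
      rw [h1]; exact inv_ne_zero hβD
    have hβα : β = (algebraMap F L (σ⁻¹ 0 0) * α + algebraMap F L (σ⁻¹ 0 1)) /
        (algebraMap F L (σ⁻¹ 1 0) * α + algebraMap F L (σ⁻¹ 1 1)) := by
      rw [h1, h3, mul_div_cancel_right₀ _ (inv_ne_zero hβD)]
    have hroot : aeval α (P σ⁻¹ (C u * (X ^ N - C θ))) = 0 := by
      rw [aeval_P σ⁻¹ _ hne, ← hβα]
      simp [hβN]
    have hαtop : IntermediateField.adjoin F {α} = ⊤ := by
      rw [← top_le_iff, ← hβtop, IntermediateField.adjoin_simple_le_iff, hβα]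
      have hmem := IntermediateField.mem_adjoin_simple_self F α
      exact div_mem (add_mem (mul_mem (algebraMap_mem _ _) hmem) (algebraMap_mem _ _))
        (add_mem (mul_mem (algebraMap_mem _ _) hmem) (algebraMap_mem _ _))
    rw [Field.primitive_element_iff_minpoly_natDegree_eq, hfin] at hαtop
    have hg0 : P σ⁻¹ (C u * (X ^ N - C θ)) ≠ 0 := fun h => hN (by rw [← hdeg, h, natDegree_zero])
    exact (associated_of_dvd_of_natDegree_le (minpoly.dvd F α hroot) hg0
      (by rw [hdeg, hαtop])).irreducible (minpoly.irreducible (IsIntegral.of_finite F α))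
  · intro L _ _ hfin α hα
    rw [hdeg] at hfin
    have : FiniteDimensional F L := Module.finite_of_finrank_pos (by omega)
    -- At a pole of σ⁻¹ the value is a nonzero constant times a power of the numerator, and
    -- numerator and denominator cannot both vanish.
    have hne : algebraMap F L (σ⁻¹ 1 0) * α + algebraMap F L (σ⁻¹ 1 1) ≠ 0 := by
      intro h
      rw [aeval_P_of_eq_zero σ⁻¹ _ h, hdegN] at hα
      have hlead : (C u * (X ^ N - C θ)).leadingCoeff ≠ 0 :=
        leadingCoeff_ne_zero.mpr (mul_ne_zero (C_ne_zero.mpr hu) hirr.ne_zero)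
      have h0 := eq_zero_of_pow_eq_zero
        ((mul_eq_zero.mp hα).resolve_left ((_root_.map_ne_zero _).mpr hlead))
      obtain ⟨-, -, h3, h4⟩ := mul_inv_entries σ L
      apply one_ne_zero (α := L)
      linear_combination algebraMap F L (σ 1 0) * h0 + algebraMap F L (σ 1 1) * h - α * h3 - h4
    obtain ⟨h1, h3⟩ := linearFractional_inv σ hne rfl
    rw [aeval_P σ⁻¹ _ hne] at hα
    have hα' := (mul_eq_zero.mp hα).resolve_left (pow_ne_zero _ hne)
    generalize (algebraMap F L (σ⁻¹ 0 0) * α + algebraMap F L (σ⁻¹ 0 1)) /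
        (algebraMap F L (σ⁻¹ 1 0) * α + algebraMap F L (σ⁻¹ 1 1)) = β at h1 h3 hα'
    have hβN : β ^ N = algebraMap F L θ := by
      simpa [hu, sub_eq_zero] using hα'
    have hαβ : α = (algebraMap F L (σ 0 0) * β + algebraMap F L (σ 0 1)) /
        (algebraMap F L (σ 1 0) * (β - algebraMap F L D)) := by
      rw [← hden L, h1, h3, mul_div_cancel_right₀ _ (inv_ne_zero hne)]
    rw [hαβ]
    subst hfin
    exact isCompletelyNormalElement_linearFractional hp h2 hθ0 hθ hβN hc hD hdet hθD htr

end RTransform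

/-! ### The three cases. -/

theorem mainTheorem1 {F : Type*} [Field F] [Finite F] (a b c d A : F)
    (σ : Matrix.GeneralLinearGroup (Fin 2) F)
    (hσ : (σ : Matrix (Fin 2) (Fin 2) F) = !![a, b; c, d]) (t : ℕ)
    (h : RTransform.BassaMenares σ t (X - C A)) (hdc : d * c ≠ 0) :
    (a * b = 0 →
      ∀ k : ℕ, RTransform.IsCompletelyNormalPoly (RTransform.gSeq σ t (X - C A) k)) ∧
    (a * b ≠ 0 → (∃ ℓ : ℕ, ℓ.Prime ∧ ℓ ∣ t ∧ ∃ y : F, b * c / (a * d) = y ^ ℓ) →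
      ∀ k : ℕ, (k ≠ 0 ∨ A ≠ 0) →
        RTransform.IsCompletelyNormalPoly (RTransform.gSeq σ t (X - C A) k)) ∧
    (a * b ≠ 0 → d = -c → A ≠ 0 →
      ∀ k : ℕ, RTransform.IsCompletelyNormalPoly (RTransform.gSeq σ t (X - C A) k)) := by
  have hd : d ≠ 0 := left_ne_zero_of_mul hdc
  have hc : c ≠ 0 := right_ne_zero_of_mul hdc
  have e00 : σ 0 0 = a := by simp [hσ]
  have e01 : σ 0 1 = b := by simp [hσ]
  have e10 : σ 1 0 = c := by simp [hσ]
  have e11 : σ 1 1 = d := by simp [hσ]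
  obtain ⟨h1, -, h3, -⟩ := RTransform.mul_inv_entries σ F
  simp only [Algebra.algebraMap_self, RingHom.id_apply, e00, e01, e10, e11] at h1 h3
  have hdet' : σ⁻¹ 1 0 * (b * c - a * d) = c := by linear_combination c * h1 - a * h3
  have hc' : σ⁻¹ 1 0 ≠ 0 := fun h => hc (by rw [← hdet', h, zero_mul])
  have hdet : b * c - a * d ≠ 0 := fun h => hc (by rw [← hdet', h, mul_zero])
  have hD : -(d / c) ≠ 0 := neg_ne_zero.mpr (div_ne_zero hd hc)
  have hD' : σ⁻¹ 0 0 / σ⁻¹ 1 0 = -(d / c) := by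
    field_simp
    linear_combination h3
  have hdetD : b + a * -(d / c) ≠ 0 := by
    intro h
    apply hdet
    field_simp at h
    linear_combination h
  have hA : A ≠ a / c := by
    rintro rfl
    exact h.ne_pole (by rwa [e10]) (by rw [e00, e10])
  have hu : a - c * A ≠ 0 := fun h0 => hA (by field_simp; linear_combination -h0)
  obtain ⟨θ, hθ⟩ : ∃ θ, θ = RTransform.eta σ (X - C A) := ⟨_, rfl⟩
  have huθ : (a - c * A) * θ = d * A - b := by
    have hpole : a / c - A ≠ 0 := sub_ne_zero.mpr hA.symm
    rw [hθ, RTransform.eta, e00, e01, e10, e11, if_neg hc, if_neg hd]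
    simp only [natDegree_X_sub_C, pow_one, eval_sub, eval_X, eval_C]
    have : a - c * A = c * (a / c - A) := by field_simp
    rw [this]
    field_simp
    ring
  have hpow : ∀ l : ℕ, l.Prime → l ∣ t → ∀ y : F, y ^ l ≠ θ := fun l hl hlt y hy =>
    h.eta_not_power l hl hlt ⟨y, by rw [← hθ, hy]⟩
  obtain ⟨p, hpp, hpt⟩ := Nat.exists_prime_and_dvd (n := t) (by have := h.two_le; omega)
  have hθ0 : θ ≠ 0 := fun h0 => hpow p hpp hpt 0 (by rw [h0, zero_pow hpp.ne_zero])
  have hpowD : ∀ (l k : ℕ) (z : F), l.Prime → l ∣ t → k ≠ 0 → z ^ t ^ k ≠ θ := by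
    intro l k z hl hlt hk hz
    obtain ⟨e, he⟩ := hlt.trans (dvd_pow_self t hk)
    rw [he, mul_comm, pow_mul] at hz
    exact hpow l hl hlt _ hz
  have hθD : ∀ k, (-(d / c)) ^ t ^ k ≠ θ := by
    intro k hk
    by_cases hk0 : k = 0
    · rw [hk0, pow_zero, pow_one] at hk
      rw [← hk] at huθ
      apply hdet
      field_simp at huθ
      linear_combination huθ
    · exact hpowD p k _ hpp hpt hk0 hk
  have h4 : 2 ∣ t → 4 ∣ Nat.card F - 1 := fun ht => by
    have hq := h.prime_dvd 2 Nat.prime_two ht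
    have hq1 : 1 < Nat.card F := Finite.one_lt_card
    have hq3 : Nat.card F % 4 ≠ 3 := fun h0 => by
      -- The degree of x - A is odd, so q ≡ 3 mod 4 is excluded for even t.
      have := h.even_degree h0 (even_iff_two_dvd.mpr ht)
      simp at this
    omega
  have hN : ∀ k, t ^ k ≠ 0 := fun k => pow_ne_zero k (by have := h.two_le; omega)
  have main : ∀ k, a * θ + b * (-(d / c)) ^ (t ^ k - 1) ≠ 0 →
      RTransform.IsCompletelyNormalPoly (RTransform.gSeq σ t (X - C A) k) := by
    intro k htr
    rw [RTransform.gSeq_X_sub_C σ (by rwa [e10]) hc' (θ := θ) (by rwa [e00, e10])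
      (by rw [e00, e01, e10, e11, huθ]) (by rwa [hD']) k]
    refine RTransform.isCompletelyNormalPoly_P_inv σ (by rwa [e10]) hc' hD
      (by rw [e10, e11]; field_simp) hD' (by rwa [e01, e00]) (hN k)
      (fun l hl hlk => h.prime_dvd l hl (hl.dvd_of_dvd_pow hlk))
      (fun h2 => h4 (Nat.prime_two.dvd_of_dvd_pow h2)) (by rwa [e00, e10]) hθ0
      (fun l hl hlk => hpow l hl (hl.dvd_of_dvd_pow hlk)) (hθD k).symm (by rwa [e00, e01])
  -- Indeed u(aθ + b) = A(ad - bc).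
  have hone : A ≠ 0 → a * θ + b ≠ 0 := by
    intro hA0 h0
    apply mul_ne_zero hA0 hdet
    linear_combination a * huθ - (a - c * A) * h0
  refine ⟨fun hab k => main k ?_, fun hab ⟨l, hl, hlt, y, hy⟩ k hk => main k ?_,
    fun hab hdc' hA0 k => main k ?_⟩
  · rcases mul_eq_zero.mp hab with ha | hb
    · rw [ha, zero_mul, zero_add]
      have hb : b ≠ 0 := by rintro rfl; simp [ha] at hdet
      exact mul_ne_zero hb (pow_ne_zero _ hD)
    · rw [hb, zero_mul, add_zero]
      have ha : a ≠ 0 := by rintro rfl; simp [hb] at hdet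
      exact mul_ne_zero ha hθ0
  · by_cases hk0 : k = 0
    · simpa [hk0] using hone (hk.resolve_left (not_not.mpr hk0))
    · intro h0
      obtain ⟨e, he⟩ := hlt.trans (dvd_pow_self t hk0)
      have ha : a ≠ 0 := left_ne_zero_of_mul hab
      -- aθ = -bD^(N-1) would give θ = (bc/(ad)) D^N, and N = l * e.
      refine hpow l hl hlt (y * (-(d / c)) ^ e) ?_
      rw [mul_pow, ← hy, ← pow_mul, mul_comm e l, ← he, ← mul_pow_sub_one (hN k)]
      generalize (-(d / c)) ^ (t ^ k - 1) = z at h0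
      field_simp
      linear_combination -h0
  -- Here D = 1, so the condition is aθ + b ≠ 0 for every k.
  · have : -(d / c) = 1 := by rw [hdc']; field_simp
    simpa [this] using hone hA0
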